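/- Let $X\subset\mathbb{C}$ be compact and let $C(X)$ be the algebra of continuous functions $X\to\mathbb{C}$, with uniform norm $|\cdot|_X$. A path in $X$ is a continuous map $\gamma:[a,b]\to X$ with $a<b$; put $\gamma^-=\gamma(a)$ and $\gamma^+=\gamma(b)$. A subpath of $\gamma$ is its restriction to a non-degenerate closed subinterval of $[a,b]$. A path is admissible if it is rectifiable and has no constant subpath. The set $X$ is semi-rectifiable if the union of the images of all injective rectifiable paths in $X$ is dense in $X$. A family $\mathcal F$ of paths in $X$ is effective if each of its members is admissible, each subpath of a member is a member, and the union of the images of its members is dense in $X$. For $f,g\in C(X)$, $g$ is an $\mathcal F$-derivative of $f$ if $$\int_\gamma g(z)\,dz=f(\gamma^+)-f(\gamma^-)\qquad(\gamma\in\mathcal F),$$ where the integral is the Riemann--Stieltjes integral along the rectifiable path $\gamma$. Let $D^{(1)}_{\mathcal F}(X)$ be the set of all $f\in C(X)$ that have an $\mathcal F$-derivative in $C(X)$. Let $D^{(1)}(X)$ be the algebra of functions $f \in C(X)$ for which $f'(a)=\lim_{z\to a,\,z\in X}\frac{f(z)-f(a)}{z-a}$ exists for every $a\in X$ and $f'$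 is continuous on $X$. A Banach function algebra on $X$ is a subalgebra $A$ of $C(X)$ that contains the constants and separates the points of $X$, with a complete submultiplicative norm $\|\cdot\|$ on $A$ such that $\|f\|\ge|f|_X$ for all $f\in A$. **Theorem.** Let $X$ be a semi-rectifiable, compact plane set, and let $\mathcal F$ be an effective family of paths in $X$. 1. If $f_1,f_2\in C(X)$ have $\mathcal F$-derivatives $g_1,g_2\in C(X)$, respectively, then $f_1g_2+g_1f_2$ is an $\mathcal F$-derivative of $f_1f_2$. 2. Each $f\in D^{(1)}_{\mathcal F}(X)$ has exactly one $\mathcal F$-derivative $f'\in C(X)$; and $D^{(1)}_{\mathcal F}(X)$, with the norm $\|f\|=|f|_X+|f'|_X$, is a Banach function algebra on $X$ that contains $D^{(1)}(X)$ as a subalgebra. -/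

import Mathlib

open Filter Topology

namespace PlaneDiff

/-- A path in a plane set `X`: a continuous map from a non-degenerate closed interval `[a, b]`
into `X`. -/
structure PathIn (X : Set ℂ) where
  a : ℝ
  b : ℝ
  lt : a < b
  toFun : C(Set.Icc a b, X)

namespace PathIn

variable {X : Set ℂ}

/-- The starting point of the parameter interval. -/
def left (γ : PathIn X) : Set.Icc γ.a γ.b := ⟨γ.a, Set.left_mem_Icc.2 γ.lt.le⟩

/-- The end point of the parameter interval. -/
def right (γ : PathIn X) : Set.Icc γ.a γ.b := ⟨γ.b, Set.right_mem_Icc.2 γ.lt.le⟩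

/-- The initial endpoint of `γ`. -/
noncomputable def source (γ : PathIn X) : X := γ.toFun γ.left

/-- The final endpoint of `γ`. -/
noncomputable def target (γ : PathIn X) : X := γ.toFun γ.right

/-- The image of `γ`, as a subset of the plane. -/
def image (γ : PathIn X) : Set ℂ := Set.range fun t => (γ.toFun t : ℂ)

/-- The length of `γ`, which is `∞` when `γ` is not rectifiable. -/
noncomputable def length (γ : PathIn X) : ENNReal :=
  eVariationOn (fun t => (γ.toFun t : ℂ)) Set.univ

/-- `γ` has finite length. -/
def IsRectifiable (γ : PathIn X) : Prop := γ.length ≠ ⊤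

/-- `γ` is an injective path. -/
def IsJordan (γ : PathIn X) : Prop := Function.Injective γ.toFun

/-- The restriction of `γ` to a non-degenerate closed subinterval `[c, d]`. -/
noncomputable def restrict (γ : PathIn X) (c d : ℝ) (hc : γ.a ≤ c) (hcd : c < d) (hd : d ≤ γ.b) : PathIn X where
  a := c
  b := d
  lt := hcd
  toFun := γ.toFun.comp
    ⟨Set.inclusion (Set.Icc_subset_Icc hc hd), continuous_inclusion (Set.Icc_subset_Icc hc hd)⟩

/-- `σ` is a subpath of `γ`. -/
def IsSubpath (σ γ : PathIn X) : Prop :=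
  ∃ (c d : ℝ) (hc : γ.a ≤ c) (hcd : c < d) (hd : d ≤ γ.b), σ = γ.restrict c d hc hcd hd

/-- `γ` takes only one value. -/
def IsConstant (γ : PathIn X) : Prop := ∃ w : X, ∀ t, γ.toFun t = w

/-- A path is admissible if it is rectifiable and has no constant subpath. -/
def IsAdmissible (γ : PathIn X) : Prop :=
  γ.IsRectifiable ∧ ∀ σ : PathIn X, σ.IsSubpath γ → ¬ σ.IsConstant

/-- The points `t 0 ≤ ⋯ ≤ t n` divide the parameter interval of `γ` into pieces of length less
than `δ`, and each tag `s i` lies in the piece from `t i` to `t (i + 1)`. Only the values `t i`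
with `i ≤ n` and `s i` with `i < n` matter. -/
def IsTaggedPartition (γ : PathIn X) (δ : ℝ) (n : ℕ) (t s : ℕ → Set.Icc γ.a γ.b) : Prop :=
  t 0 = γ.left ∧ t n = γ.right ∧
    ∀ i < n, t i ≤ s i ∧ s i ≤ t (i + 1) ∧ (t (i + 1) : ℝ) - (t i : ℝ) < δ

/-- The Riemann–Stieltjes sum of `g` along `γ`. -/
noncomputable def riemannSum (γ : PathIn X) (g : C(X, ℂ)) (n : ℕ)
    (t s : ℕ → Set.Icc γ.a γ.b) : ℂ :=
  ∑ i ∈ Finset.range n,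
    g (γ.toFun (s i)) * ((γ.toFun (t (i + 1)) : ℂ) - (γ.toFun (t i) : ℂ))

/-- The path integral `∫_γ g` exists as a Riemann–Stieltjes integral, and is equal to `I`. -/
def HasIntegral (γ : PathIn X) (g : C(X, ℂ)) (I : ℂ) : Prop :=
  ∀ ε > 0, ∃ δ > 0, ∀ (n : ℕ) (t s : ℕ → Set.Icc γ.a γ.b),
    γ.IsTaggedPartition δ n t s → ‖γ.riemannSum g n t s - I‖ < ε

end PathIn

/-- The union of the rectifiable Jordan arcs in `X` is dense in `X`. -/
def IsSemiRectifiable (X : Set ℂ) : Prop :=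
  X ⊆ closure (⋃ γ ∈ {γ : PathIn X | γ.IsRectifiable ∧ γ.IsJordan}, γ.image)

/-- A family of paths in `X` is effective if its members are admissible, it is closed under passing
to subpaths, and the union of the images of its members is dense in `X`. -/
structure IsEffective {X : Set ℂ} (F : Set (PathIn X)) : Prop where
  admissible : ∀ γ ∈ F, γ.IsAdmissible
  subpath_mem : ∀ γ ∈ F, ∀ σ : PathIn X, σ.IsSubpath γ → σ ∈ F
  dense : X ⊆ closure (⋃ γ ∈ F, γ.image)

/-- `g` is an `F`-derivative of `f`. -/
def IsFDerivative {X : Set ℂ} (F : Set (PathIn X)) (f g : C(X, ℂ)) : Prop :=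
  ∀ γ ∈ F, γ.HasIntegral g (f γ.target - f γ.source)

/-- The set of continuous functions on `X` with an `F`-derivative in `C(X)`. -/
def FDifferentiable {X : Set ℂ} (F : Set (PathIn X)) : Set C(X, ℂ) :=
  {f | ∃ g : C(X, ℂ), IsFDerivative F f g}

/-- `f` is complex differentiable on `X` (with limits taken within `X`), with derivative `g`. -/
def HasDerivOn {X : Set ℂ} (f g : C(X, ℂ)) : Prop :=
  ∀ z : X, Tendsto (fun w : X => (f w - f z) / ((w : ℂ) - (z : ℂ))) (𝓝[≠] z) (𝓝 (g z))

theorem HasDerivOn.const {X : Set ℂ} (c : ℂ) :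
    HasDerivOn (algebraMap ℂ C(X, ℂ) c) 0 := by
  intro z
  simpa using tendsto_const_nhds

theorem HasDerivOn.add {X : Set ℂ} {f₁ f₂ g₁ g₂ : C(X, ℂ)} (h₁ : HasDerivOn f₁ g₁)
    (h₂ : HasDerivOn f₂ g₂) : HasDerivOn (f₁ + f₂) (g₁ + g₂) := by
  intro z
  refine ((h₁ z).add (h₂ z)).congr fun w => ?_
  simp only [ContinuousMap.add_apply]
  ring

theorem HasDerivOn.mul {X : Set ℂ} {f₁ f₂ g₁ g₂ : C(X, ℂ)} (h₁ : HasDerivOn f₁ g₁)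
    (h₂ : HasDerivOn f₂ g₂) : HasDerivOn (f₁ * f₂) (f₁ * g₂ + g₁ * f₂) := by
  intro z
  have hc : Tendsto (fun w : X => f₁ w) (𝓝[≠] z) (𝓝 (f₁ z)) :=
    (f₁.continuous.tendsto z).mono_left nhdsWithin_le_nhds
  refine ((hc.mul (h₂ z)).add ((h₁ z).mul_const (f₂ z))).congr fun w => ?_
  simp only [ContinuousMap.mul_apply]
  ring

/-- The algebra of continuously (complex) differentiable functions on `X`. -/
def contDiffAlgebra (X : Set ℂ) : Subalgebra ℂ C(X, ℂ) where
  carrier := {f | ∃ g : C(X, ℂ), HasDerivOn f g}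
  mul_mem' := by
    rintro f₁ f₂ ⟨g₁, h₁⟩ ⟨g₂, h₂⟩
    exact ⟨_, h₁.mul h₂⟩
  add_mem' := by
    rintro f₁ f₂ ⟨g₁, h₁⟩ ⟨g₂, h₂⟩
    exact ⟨_, h₁.add h₂⟩
  algebraMap_mem' c := ⟨0, HasDerivOn.const c⟩

/-- `(A, N)` is a Banach function algebra on the compact space `K`. That `A` is a subalgebra of
`C(K)` containing the constants, and that `N` is a submultiplicative norm on it, is part of the
types of `A` and `N`. -/
structure IsBanachFunctionAlgebra {K : Type*} [TopologicalSpace K] [CompactSpace K]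
    (A : Subalgebra ℂ C(K, ℂ)) (N : AlgebraNorm ℂ A) : Prop where
  separatesPoints : A.SeparatesPoints
  norm_le : ∀ f : A, ‖(f : C(K, ℂ))‖ ≤ N f
  complete : ∀ u : ℕ → A, (∀ ε > 0, ∃ n₀, ∀ m ≥ n₀, ∀ n ≥ n₀, N (u m - u n) < ε) →
    ∃ f : A, Tendsto (fun n => N (u n - f)) atTop (𝓝 0)

end PlaneDiff

/-! Everything is reduced to one increment estimate along a path. Let `v` be a monotone function
dominating the displacement of a rectifiable path. If `g` stays within `M` of a constant `c` on a
stretch, then the increment of `f` differs from `c` times the displacement by at most `M` times the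
increment of `v` (`IncrementBound`). An effective family yields this because subpaths of members are
members; conversely, summing the estimate over fine partitions recovers the integral. The product
rule is then local algebra.

Uniqueness: if `0` has derivative `g` and `g` is near `c ≠ 0` on a subpath, the estimate turns every
control `v` into the control `v / 2`. Iterating, the subpath is constant, against admissibility. So
`g` vanishes on all members, and by density everywhere.

A complex differentiable `f` satisfies the estimate by a mean value inequality, obtained by chaining
local bounds along the path. Completeness holds because integrals pass to uniform limits. -/

/-- Chaining along an interval: a relation between points `x ≤ y` of `[s, t]` that can be composed
and that holds between each point and its neighbours holds between `s` and `t`. -/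
theorem rel_of_locally_of_trans {P : ℝ → ℝ → Prop} {s t : ℝ} (hst : s ≤ t)
    (trans : ∀ x y z, s ≤ x → x ≤ y → y ≤ z → z ≤ t → P x y → P y z → P x z)
    (loc : ∀ τ ∈ Set.Icc s t, ∀ᶠ x in 𝓝 τ, x ∈ Set.Icc s t →
      (x ≤ τ → P x τ) ∧ (τ ≤ x → P τ x)) : P s t := by
  -- Continuous induction: `sSup S` is attained because points of `S` lie arbitrarily near it, and
  -- it cannot be below `t` because a point just to its right would again be in `S`.
  set S : Set ℝ := {x | x ∈ Set.Icc s t ∧ P s x} with hS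
  have hs : s ∈ S := by
    have hm : s ∈ Set.Icc s t := Set.left_mem_Icc.2 hst
    exact ⟨hm, ((loc s hm).self_of_nhds hm).1 le_rfl⟩
  have hbdd : BddAbove S := ⟨t, fun x hx => hx.1.2⟩
  have hlub : IsLUB S (sSup S) := isLUB_csSup ⟨s, hs⟩ hbdd
  set c := sSup S
  have hc : c ∈ Set.Icc s t := ⟨hlub.1 hs, hlub.2 fun x hx => hx.1.2⟩
  have hcS : c ∈ S := by
    have hf : ∃ᶠ x in 𝓝 c, x ∈ S :=
      (hlub.frequently_mem ⟨s, hs⟩).filter_mono nhdsWithin_le_nhds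
    obtain ⟨x, hxS, hx⟩ := (hf.and_eventually (loc c hc)).exists
    have hxc : x ≤ c := hlub.1 hxS
    exact ⟨hc, trans s x c le_rfl hxS.1.1 hxc hc.2 hxS.2 ((hx hxS.1).1 hxc)⟩
  rcases hc.2.eq_or_lt with h | h
  · exact h ▸ hcS.2
  · exfalso
    have hev : ∀ᶠ x in 𝓝[>] c, x ∈ Set.Ioo c t ∧ (x ∈ Set.Icc s t →
        (x ≤ c → P x c) ∧ (c ≤ x → P c x)) :=
      Filter.Eventually.and (Ioo_mem_nhdsGT h) (nhdsWithin_le_nhds (loc c hc))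
    obtain ⟨x, hx, hx'⟩ := hev.exists
    have hxm : x ∈ Set.Icc s t := ⟨hc.1.trans hx.1.le, hx.2.le⟩
    have hxS : x ∈ S :=
      ⟨hxm, trans s c x le_rfl hc.1 hx.1.le hx.2.le hcS.2 ((hx' hxm).2 hx.1.le)⟩
    exact absurd (hlub.1 hxS) (not_le.2 hx.1)

namespace PlaneDiff

variable {X : Set ℂ}

namespace PathIn

/-! ### Control functions and Riemann sums -/

/-- `v` dominates the variation of `γ` on every subinterval. -/
def IsControl (γ : PathIn X) (v : Set.Icc γ.a γ.b → ℝ) : Prop :=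
  ∀ s t, s ≤ t → ‖(γ.toFun t : ℂ) - γ.toFun s‖ ≤ v t - v s

theorem IsRectifiable.exists_isControl {γ : PathIn X} (h : γ.IsRectifiable) :
    ∃ v, γ.IsControl v := by
  set φ : Set.Icc γ.a γ.b → ℂ := fun t => (γ.toFun t : ℂ)
  have hφ : LocallyBoundedVariationOn φ Set.univ :=
    BoundedVariationOn.locallyBoundedVariationOn h
  refine ⟨fun t => variationOnFromTo φ Set.univ γ.left t, fun s t hst => ?_⟩
  have hadd := variationOnFromTo.add hφ (Set.mem_univ γ.left) (Set.mem_univ s) (Set.mem_univ t)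
  have hle : dist (φ t) (φ s) ≤ variationOnFromTo φ Set.univ s t := by
    rw [variationOnFromTo.eq_of_le φ Set.univ hst, dist_edist]
    refine ENNReal.toReal_mono (hφ s t (Set.mem_univ s) (Set.mem_univ t)) ?_
    exact eVariationOn.edist_le φ ⟨Set.mem_univ _, hst, le_rfl⟩ ⟨Set.mem_univ _, le_rfl, hst⟩
  rw [dist_eq_norm] at hle
  linarith

theorem IsControl.mono {γ : PathIn X} {v : Set.Icc γ.a γ.b → ℝ} (hv : γ.IsControl v) :
    Monotone v := fun s t hst => by
  have := (norm_nonneg _).trans (hv s t hst)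
  linarith

/-- Without partitions of every mesh, `HasIntegral` would hold vacuously and no bound on sums could
pass to the integral. -/
theorem exists_isTaggedPartition (γ : PathIn X) {δ : ℝ} (hδ : 0 < δ) :
    ∃ n t s, γ.IsTaggedPartition δ n t s := by
  -- Steps of `δ / 2` give the strict mesh bound, since consecutive points are only known to be at
  -- distance at most the step.
  have hδ' : 0 < δ / 2 := half_pos hδ
  obtain ⟨m, hm⟩ := Set.Icc.addNSMul_eq_right γ.lt.le hδ'
  have hmono := Set.Icc.monotone_addNSMul γ.lt.le hδ'.le
  refine ⟨m, fun i => Set.Icc.addNSMul γ.lt.le (δ / 2) i,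
    fun i => Set.Icc.addNSMul γ.lt.le (δ / 2) i, ?_, ?_, fun i _ => ⟨le_rfl, ?_, ?_⟩⟩
  · exact Subtype.ext (Set.Icc.addNSMul_zero γ.lt.le)
  · exact Subtype.ext (hm m le_rfl)
  · exact hmono i.le_succ
  · have := Set.Icc.abs_sub_addNSMul_le γ.lt.le hδ'.le i
      (Set.right_mem_Icc.2 (hmono i.le_succ))
    have h2 := (le_abs_self _).trans this
    linarith

theorem IsTaggedPartition.norm_sum_le {γ : PathIn X} {v : Set.Icc γ.a γ.b → ℝ} {δ : ℝ} {n : ℕ}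
    {t s : ℕ → Set.Icc γ.a γ.b} (h : γ.IsTaggedPartition δ n t s) {e : ℕ → ℂ} {C : ℝ}
    (he : ∀ i < n, ‖e i‖ ≤ C * (v (t (i + 1)) - v (t i))) :
    ‖∑ i ∈ Finset.range n, e i‖ ≤ C * (v γ.right - v γ.left) := by
  calc ‖∑ i ∈ Finset.range n, e i‖
      ≤ ∑ i ∈ Finset.range n, C * (v (t (i + 1)) - v (t i)) :=
        norm_sum_le_of_le _ fun i hi => he i (Finset.mem_range.1 hi)
    _ = C * (v γ.right - v γ.left) := by
        rw [← Finset.mul_sum, Finset.sum_range_sub (fun i => v (t i)), h.1, h.2.1]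

theorem IsTaggedPartition.sum_sub {γ : PathIn X} {δ : ℝ} {n : ℕ}
    {t s : ℕ → Set.Icc γ.a γ.b} (h : γ.IsTaggedPartition δ n t s) (φ : Set.Icc γ.a γ.b → ℂ) :
    ∑ i ∈ Finset.range n, (φ (t (i + 1)) - φ (t i)) = φ γ.right - φ γ.left := by
  rw [Finset.sum_range_sub (fun i => φ (t i)), h.1, h.2.1]

theorem IsTaggedPartition.le_succ {γ : PathIn X} {δ : ℝ} {n : ℕ}
    {t s : ℕ → Set.Icc γ.a γ.b} (h : γ.IsTaggedPartition δ n t s) {i : ℕ} (hi : i < n) :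
    t i ≤ t (i + 1) := (h.2.2 i hi).1.trans (h.2.2 i hi).2.1

/-- The sum for the constant `c` telescopes to `c` times the total displacement, so only `g - c`
contributes to the error. -/
theorem IsTaggedPartition.norm_riemannSum_sub_le {γ : PathIn X} {v : Set.Icc γ.a γ.b → ℝ}
    (hv : γ.IsControl v) {δ : ℝ} {n : ℕ} {t s : ℕ → Set.Icc γ.a γ.b}
    (h : γ.IsTaggedPartition δ n t s) {g : C(X, ℂ)} {c : ℂ} {M : ℝ}
    (hg : ∀ u, ‖g (γ.toFun u) - c‖ ≤ M) :
    ‖γ.riemannSum g n t s - c * ((γ.target : ℂ) - γ.source)‖ ≤ M * (v γ.right - v γ.left) := by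
  have hsum := h.sum_sub fun u => (γ.toFun u : ℂ)
  change _ = (γ.target : ℂ) - γ.source at hsum
  rw [riemannSum, ← hsum, Finset.mul_sum, ← Finset.sum_sub_distrib]
  refine h.norm_sum_le fun i hi => ?_
  rw [← sub_mul, norm_mul]
  exact mul_le_mul (hg _) (hv _ _ (h.le_succ hi)) (norm_nonneg _)
    ((norm_nonneg _).trans (hg γ.left))

/-! ### Estimates, linearity and limits of integrals -/

theorem HasIntegral.norm_sub_le {γ : PathIn X} {v : Set.Icc γ.a γ.b → ℝ}
    (hv : γ.IsControl v) {g : C(X, ℂ)} {I c : ℂ} {M : ℝ} (hI : γ.HasIntegral g I)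
    (hg : ∀ u, ‖g (γ.toFun u) - c‖ ≤ M) :
    ‖I - c * ((γ.target : ℂ) - γ.source)‖ ≤ M * (v γ.right - v γ.left) := by
  refine le_of_forall_pos_le_add fun ε hε => ?_
  obtain ⟨δ, hδ, H⟩ := hI ε hε
  obtain ⟨n, t, s, hp⟩ := γ.exists_isTaggedPartition hδ
  have h1 := H n t s hp
  have h2 := hp.norm_riemannSum_sub_le hv hg
  rw [norm_sub_rev] at h1
  have h3 := norm_sub_le_norm_sub_add_norm_sub I (γ.riemannSum g n t s)
    (c * ((γ.target : ℂ) - γ.source))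
  linarith

theorem HasIntegral.add {γ : PathIn X} {g₁ g₂ : C(X, ℂ)} {I₁ I₂ : ℂ}
    (h₁ : γ.HasIntegral g₁ I₁) (h₂ : γ.HasIntegral g₂ I₂) :
    γ.HasIntegral (g₁ + g₂) (I₁ + I₂) := by
  intro ε hε
  obtain ⟨δ₁, hδ₁, H₁⟩ := h₁ (ε / 2) (half_pos hε)
  obtain ⟨δ₂, hδ₂, H₂⟩ := h₂ (ε / 2) (half_pos hε)
  refine ⟨min δ₁ δ₂, lt_min hδ₁ hδ₂, fun n t s hp => ?_⟩
  have e₁ := H₁ n t s ⟨hp.1, hp.2.1, fun i hi => ⟨(hp.2.2 i hi).1, (hp.2.2 i hi).2.1,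
    (hp.2.2 i hi).2.2.trans_le (min_le_left _ _)⟩⟩
  have e₂ := H₂ n t s ⟨hp.1, hp.2.1, fun i hi => ⟨(hp.2.2 i hi).1, (hp.2.2 i hi).2.1,
    (hp.2.2 i hi).2.2.trans_le (min_le_right _ _)⟩⟩
  have hs : γ.riemannSum (g₁ + g₂) n t s = γ.riemannSum g₁ n t s + γ.riemannSum g₂ n t s := by
    simp only [riemannSum, ContinuousMap.add_apply, add_mul, Finset.sum_add_distrib]
  rw [hs, add_sub_add_comm]
  exact (norm_add_le _ _).trans_lt (by linarith)

theorem HasIntegral.smul {γ : PathIn X} {g : C(X, ℂ)} {I : ℂ} (c : ℂ)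
    (h : γ.HasIntegral g I) : γ.HasIntegral (c • g) (c * I) := by
  intro ε hε
  obtain ⟨δ, hδ, H⟩ := h (ε / (‖c‖ + 1)) (by positivity)
  refine ⟨δ, hδ, fun n t s hp => ?_⟩
  have hs : γ.riemannSum (c • g) n t s = c * γ.riemannSum g n t s := by
    simp only [riemannSum, ContinuousMap.smul_apply, smul_eq_mul, Finset.mul_sum, mul_assoc]
  rw [hs, ← mul_sub, norm_mul]
  have h1 := H n t s hp
  rw [lt_div_iff₀ (by positivity)] at h1
  nlinarith [norm_nonneg (γ.riemannSum g n t s - I)]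

/-- Integrals pass to uniform limits of the integrand. -/
theorem HasIntegral.of_tendsto [CompactSpace X] {γ : PathIn X} (hγ : γ.IsRectifiable)
    {G : ℕ → C(X, ℂ)} {J : ℕ → ℂ} {g : C(X, ℂ)} {I : ℂ} (h : ∀ n, γ.HasIntegral (G n) (J n))
    (hG : Tendsto G atTop (𝓝 g)) (hJ : Tendsto J atTop (𝓝 I)) : γ.HasIntegral g I := by
  obtain ⟨v, hv⟩ := hγ.exists_isControl
  intro ε hε
  set L := v γ.right - v γ.left with hL
  have hL0 : 0 ≤ L := sub_nonneg.2 (hv.mono γ.lt.le)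
  -- Dividing by `L + 1` rather than `L` covers total control `L = 0`.
  have hη : 0 < ε / 3 / (L + 1) := by positivity
  obtain ⟨k, hk₁, hk₂⟩ := ((Metric.tendsto_nhds.1 hG _ hη).and
    (Metric.tendsto_nhds.1 hJ (ε / 3) (by positivity))).exists
  rw [dist_comm, dist_eq_norm] at hk₁
  rw [dist_eq_norm] at hk₂
  obtain ⟨δ, hδ, H⟩ := h k (ε / 3) (by positivity)
  refine ⟨δ, hδ, fun n t s hp => ?_⟩
  have h1 := H n t s hp
  have h2 : ‖γ.riemannSum (g - G k) n t s‖ ≤ ‖g - G k‖ * L := by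
    have := hp.norm_riemannSum_sub_le hv (g := g - G k) (c := 0) (M := ‖g - G k‖) fun u => by
      rw [sub_zero]
      exact ContinuousMap.norm_coe_le_norm _ _
    simpa using this
  have h3 : ‖g - G k‖ * L ≤ ε / 3 := by
    rw [lt_div_iff₀ (by positivity)] at hk₁
    nlinarith [norm_nonneg (g - G k)]
  have hs : γ.riemannSum g n t s - I = γ.riemannSum (g - G k) n t s +
      (γ.riemannSum (G k) n t s - J k) + (J k - I) := by
    simp only [riemannSum, ContinuousMap.sub_apply, sub_mul, Finset.sum_sub_distrib]
    ring
  rw [hs]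
  refine (norm_add₃_le).trans_lt ?_
  linarith

/-! ### Increment bounds and the product rule -/

/-- The increments of `f` along `γ` are close to those of `c z` wherever `g` is close to `c`. -/
def IncrementBound (γ : PathIn X) (v : Set.Icc γ.a γ.b → ℝ) (f g : C(X, ℂ)) : Prop :=
  ∀ s t, s ≤ t → ∀ (c : ℂ) (M : ℝ), (∀ u, s ≤ u → u ≤ t → ‖g (γ.toFun u) - c‖ ≤ M) →
    ‖f (γ.toFun t) - f (γ.toFun s) - c * ((γ.toFun t : ℂ) - γ.toFun s)‖ ≤ M * (v t - v s)

/-- Uniform continuity on the compact parameter interval makes the value at any tag a valid choice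
of the constant `c` on a short piece. -/
theorem exists_oscillation_le (γ : PathIn X) (g : C(X, ℂ)) {ε : ℝ} (hε : 0 < ε) :
    ∃ δ > 0, ∀ s u t : Set.Icc γ.a γ.b, s ≤ u → u ≤ t → (t : ℝ) - s < δ →
      ∀ w, s ≤ w → w ≤ t → ‖g (γ.toFun w) - g (γ.toFun u)‖ ≤ ε := by
  have huc : UniformContinuous fun u => g (γ.toFun u) :=
    CompactSpace.uniformContinuous_of_continuous (g.continuous.comp γ.toFun.continuous)
  obtain ⟨δ, hδ, H⟩ := Metric.uniformContinuous_iff.1 huc ε hε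
  refine ⟨δ, hδ, fun s u t hsu hut hst w hsw hwt => ?_⟩
  rw [← dist_eq_norm]
  refine (H ?_).le
  rw [Subtype.dist_eq, Real.dist_eq, abs_lt]
  have h1 : (s : ℝ) ≤ u := hsu
  have h2 : (u : ℝ) ≤ t := hut
  have h3 : (s : ℝ) ≤ w := hsw
  have h4 : (w : ℝ) ≤ t := hwt
  constructor <;> linarith

theorem IncrementBound.exists_local {γ : PathIn X} {v : Set.Icc γ.a γ.b → ℝ} {f g : C(X, ℂ)}
    (h : γ.IncrementBound v f g) {ε : ℝ} (hε : 0 < ε) :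
    ∃ δ > 0, ∀ s u t : Set.Icc γ.a γ.b, s ≤ u → u ≤ t → (t : ℝ) - s < δ →
      ‖f (γ.toFun t) - f (γ.toFun s) - g (γ.toFun u) * ((γ.toFun t : ℂ) - γ.toFun s)‖ ≤
        ε * (v t - v s) := by
  obtain ⟨δ, hδ, H⟩ := γ.exists_oscillation_le g hε
  exact ⟨δ, hδ, fun s u t hsu hut hst => h s t (hsu.trans hut) _ _ (H s u t hsu hut hst)⟩

/-- The increments of `f` telescope over a partition, and the errors are bounded by `ε` times the
telescoping increments of `v`. -/
theorem hasIntegral_of_local {γ : PathIn X} {v : Set.Icc γ.a γ.b → ℝ} (hv : Monotone v)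
    {f g : C(X, ℂ)}
    (h : ∀ ε > 0, ∃ δ > 0, ∀ s u t : Set.Icc γ.a γ.b, s ≤ u → u ≤ t → (t : ℝ) - s < δ →
      ‖f (γ.toFun t) - f (γ.toFun s) - g (γ.toFun u) * ((γ.toFun t : ℂ) - γ.toFun s)‖ ≤
        ε * (v t - v s)) :
    γ.HasIntegral g (f γ.target - f γ.source) := by
  intro ε hε
  have hL0 : 0 ≤ v γ.right - v γ.left := sub_nonneg.2 (hv γ.lt.le)
  obtain ⟨δ, hδ, H⟩ := h (ε / (v γ.right - v γ.left + 1)) (by positivity)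
  refine ⟨δ, hδ, fun n t s hp => ?_⟩
  have hsum := hp.sum_sub fun u => f (γ.toFun u)
  change _ = f γ.target - f γ.source at hsum
  rw [riemannSum, ← hsum, norm_sub_rev, ← Finset.sum_sub_distrib]
  refine (hp.norm_sum_le fun i hi => H _ _ _ (hp.2.2 i hi).1 (hp.2.2 i hi).2.1
    (hp.2.2 i hi).2.2).trans_lt ?_
  rw [div_mul_eq_mul_div, div_lt_iff₀ (by positivity)]
  nlinarith

theorem IncrementBound.hasIntegral {γ : PathIn X} {v : Set.Icc γ.a γ.b → ℝ} (hv : Monotone v)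
    {f g : C(X, ℂ)} (h : γ.IncrementBound v f g) :
    γ.HasIntegral g (f γ.target - f γ.source) :=
  hasIntegral_of_local hv fun _ hε => h.exists_local hε

/-- The product rule. -/
theorem IncrementBound.hasIntegral_mul [CompactSpace X] {γ : PathIn X}
    {v : Set.Icc γ.a γ.b → ℝ} (hv : γ.IsControl v) {f₁ f₂ g₁ g₂ : C(X, ℂ)}
    (h₁ : γ.IncrementBound v f₁ g₁) (h₂ : γ.IncrementBound v f₂ g₂) :
    γ.HasIntegral (f₁ * g₂ + g₁ * f₂) ((f₁ * f₂) γ.target - (f₁ * f₂) γ.source) := by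
  refine hasIntegral_of_local hv.mono fun ε hε => ?_
  set C := ‖f₁‖ + ‖f₂‖ + ‖g₁‖ + ‖g₂‖ + 1 with hC
  have hC0 : 0 < C := by positivity
  have hη : 0 < ε / C := by positivity
  set η := ε / C with hηdef
  obtain ⟨δ₁, hδ₁, H₁⟩ := h₁.exists_local hη
  obtain ⟨δ₂, hδ₂, H₂⟩ := h₂.exists_local hη
  obtain ⟨δ₃, hδ₃, H₃⟩ := γ.exists_oscillation_le f₁ hη
  obtain ⟨δ₄, hδ₄, H₄⟩ := γ.exists_oscillation_le f₂ hη
  refine ⟨min (min δ₁ δ₂) (min δ₃ δ₄), by positivity, fun s u t hsu hut hst => ?_⟩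
  simp only [lt_min_iff] at hst
  have hst' := hsu.trans hut
  have e₁ := H₁ s u t hsu hut hst.1.1
  have e₂ := H₂ s u t hsu hut hst.1.2
  have e₃ := H₃ s u t hsu hut hst.2.1 t hst' le_rfl
  have e₄ := H₄ s u t hsu hut hst.2.2 s le_rfl hst'
  have e₅ := hv s t hst'
  have hw : 0 ≤ v t - v s := sub_nonneg.2 (hv.mono hst')
  have n₁ := f₁.norm_coe_le_norm (γ.toFun t)
  have n₂ := f₂.norm_coe_le_norm (γ.toFun s)
  have n₃ := g₁.norm_coe_le_norm (γ.toFun u)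
  have n₄ := g₂.norm_coe_le_norm (γ.toFun u)
  simp only [ContinuousMap.mul_apply, ContinuousMap.add_apply]
  set D : ℂ := (γ.toFun t : ℂ) - γ.toFun s
  set w := v t - v s
  -- The increment of the product is `f₁(t) Δf₂ + f₂(s) Δf₁`. Replacing each `Δfᵢ` by `gᵢ(u) D`, and
  -- then moving the outer factors to the tag `u`, leaves four small terms.
  have key : f₁ (γ.toFun t) * f₂ (γ.toFun t) - f₁ (γ.toFun s) * f₂ (γ.toFun s) -
      (f₁ (γ.toFun u) * g₂ (γ.toFun u) + g₁ (γ.toFun u) * f₂ (γ.toFun u)) * D =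
      (f₁ (γ.toFun t) * (f₂ (γ.toFun t) - f₂ (γ.toFun s) - g₂ (γ.toFun u) * D) +
      f₂ (γ.toFun s) * (f₁ (γ.toFun t) - f₁ (γ.toFun s) - g₁ (γ.toFun u) * D)) +
      ((f₁ (γ.toFun t) - f₁ (γ.toFun u)) * (g₂ (γ.toFun u) * D) +
      (f₂ (γ.toFun s) - f₂ (γ.toFun u)) * (g₁ (γ.toFun u) * D)) := by ring
  rw [key]
  have b₁ : ‖f₁ (γ.toFun t) * (f₂ (γ.toFun t) - f₂ (γ.toFun s) - g₂ (γ.toFun u) * D)‖ ≤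
      ‖f₁‖ * (η * w) := by rw [norm_mul]; gcongr
  have b₂ : ‖f₂ (γ.toFun s) * (f₁ (γ.toFun t) - f₁ (γ.toFun s) - g₁ (γ.toFun u) * D)‖ ≤
      ‖f₂‖ * (η * w) := by rw [norm_mul]; gcongr
  have b₃ : ‖(f₁ (γ.toFun t) - f₁ (γ.toFun u)) * (g₂ (γ.toFun u) * D)‖ ≤
      η * (‖g₂‖ * w) := by rw [norm_mul, norm_mul]; gcongr
  have b₄ : ‖(f₂ (γ.toFun s) - f₂ (γ.toFun u)) * (g₁ (γ.toFun u) * D)‖ ≤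
      η * (‖g₁‖ * w) := by rw [norm_mul, norm_mul]; gcongr
  have hε' : ε = η * C := (div_mul_cancel₀ ε hC0.ne').symm
  refine ((norm_add_le _ _).trans (add_le_add ((norm_add_le _ _).trans (add_le_add b₁ b₂))
    ((norm_add_le _ _).trans (add_le_add b₃ b₄)))).trans ?_
  have hηw : 0 ≤ η * w := by positivity
  rw [hε', hC]
  linarith

/-- A rectifiable path along which `0` has a derivative that stays away from zero is constant. -/
theorem isConstant_of_incrementBound_zero {γ : PathIn X} (hγ : γ.IsRectifiable) {g : C(X, ℂ)}
    (h : ∀ v, γ.IsControl v → γ.IncrementBound v 0 g) {c : ℂ} (hc : c ≠ 0)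
    (hg : ∀ u, ‖g (γ.toFun u) - c‖ ≤ ‖c‖ / 2) : γ.IsConstant := by
  have hc0 : 0 < ‖c‖ := norm_pos_iff.2 hc
  obtain ⟨v, hv⟩ := hγ.exists_isControl
  -- Taking `f = 0` and `M = ‖c‖ / 2` bounds `‖c‖` times the displacement by half of `‖c‖` times the
  -- increment of `w`. Iteration is possible because `h` covers every control.
  have halve : ∀ w, γ.IsControl w → γ.IsControl fun u => w u / 2 := by
    intro w hw s t hst
    have := h w hw s t hst c (‖c‖ / 2) fun u _ _ => hg u
    simp only [ContinuousMap.zero_apply, sub_zero, zero_sub, norm_neg, norm_mul] at this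
    refine le_of_mul_le_mul_left ?_ hc0
    linarith
  have hpow : ∀ n : ℕ, γ.IsControl fun u => v u * (1 / 2) ^ n := by
    intro n
    induction n with
    | zero => simpa using hv
    | succ n ih =>
      have := halve _ ih
      simpa only [pow_succ, mul_div_assoc, mul_assoc, mul_one_div] using this
  refine ⟨γ.source, fun t => Subtype.ext (sub_eq_zero.1 (norm_le_zero_iff.1 ?_))⟩
  have hlim : Tendsto (fun n : ℕ => v t * (1 / 2 : ℝ) ^ n - v γ.left * (1 / 2) ^ n) atTop
      (𝓝 (v t * 0 - v γ.left * 0)) :=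
    have hp := tendsto_pow_atTop_nhds_zero_of_lt_one (r := (1 / 2 : ℝ)) (by norm_num) (by norm_num)
    (hp.const_mul _).sub (hp.const_mul _)
  rw [mul_zero, mul_zero, sub_zero] at hlim
  exact ge_of_tendsto' hlim fun n => hpow n γ.left t t.2.1

theorem IsControl.restrict {γ : PathIn X} {v : Set.Icc γ.a γ.b → ℝ} (hv : γ.IsControl v)
    {c d : ℝ} (hc : γ.a ≤ c) (hcd : c < d) (hd : d ≤ γ.b) :
    (γ.restrict c d hc hcd hd).IsControl fun u => v (Set.inclusion (Set.Icc_subset_Icc hc hd) u) :=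
  fun _ _ hst => hv _ _ hst

/-! ### Mean value inequality for complex differentiable functions -/

/-- A function that is complex differentiable on `X` satisfies the mean value inequality along
every path of finite length. -/
theorem incrementBound_of_hasDerivOn {γ : PathIn X} {v : Set.Icc γ.a γ.b → ℝ}
    (hv : γ.IsControl v) {f g : C(X, ℂ)} (h : HasDerivOn f g) : γ.IncrementBound v f g := by
  intro s t hst c M hM
  -- Projecting onto the parameter interval extends the path to all of `ℝ`, where the chaining lemma
  -- applies.
  set pr := Set.projIcc γ.a γ.b γ.lt.le with hpr
  have hw : 0 ≤ v t - v s := sub_nonneg.2 (hv.mono hst)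
  set H : ℝ → ℂ := fun x => f (γ.toFun (pr x)) - c * (γ.toFun (pr x) : ℂ) with hH
  have hprs : pr s = s := Set.projIcc_val γ.lt.le s
  have hprt : pr t = t := Set.projIcc_val γ.lt.le t
  -- The slack `ε` absorbs the error of the linear approximation at each point.
  suffices hS : ∀ ε > 0, ‖H t - H s‖ ≤ (M + ε) * (v (pr t) - v (pr s)) by
    simp only [hH, hprs, hprt] at hS
    refine le_of_forall_pos_le_add fun ε hε => ?_
    have h1 := hS (ε / (v t - v s + 1)) (by positivity)
    have h2 : ε / (v t - v s + 1) * (v t - v s) ≤ ε := by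
      rw [div_mul_eq_mul_div, div_le_iff₀ (by positivity)]
      nlinarith
    have h3 : f (γ.toFun t) - f (γ.toFun s) - c * ((γ.toFun t : ℂ) - γ.toFun s) =
        f (γ.toFun t) - c * γ.toFun t - (f (γ.toFun s) - c * γ.toFun s) := by ring
    rw [h3]
    linarith
  intro ε hε
  refine rel_of_locally_of_trans (P := fun x y => ‖H y - H x‖ ≤ (M + ε) * (v (pr y) - v (pr x)))
    (s := (s : ℝ)) (t := t) hst ?_ ?_
  · intro x y z _ _ _ _ hxy hyz
    have := norm_sub_le_norm_sub_add_norm_sub (H z) (H y) (H x)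
    linarith
  · intro τ hτ
    have hsτ : s ≤ pr τ := hprs ▸ Set.monotone_projIcc γ.lt.le hτ.1
    have hτt : pr τ ≤ t := hprt ▸ Set.monotone_projIcc γ.lt.le hτ.2
    have hMτ := hM (pr τ) hsτ hτt
    have hMε : 0 ≤ M + ε := add_nonneg ((norm_nonneg _).trans hMτ) hε.le
    have hloc : ∀ᶠ w : X in 𝓝 (γ.toFun (pr τ)),
        ‖f w - f (γ.toFun (pr τ)) - g (γ.toFun (pr τ)) * ((w : ℂ) - γ.toFun (pr τ))‖ ≤
          ε * ‖(w : ℂ) - γ.toFun (pr τ)‖ := by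
      have h1 := eventually_nhdsWithin_iff.1 (Metric.tendsto_nhds.1 (h (γ.toFun (pr τ))) ε hε)
      filter_upwards [h1] with w hw
      -- The difference quotient says nothing at the point itself, to which the path may return.
      by_cases hwz : w = γ.toFun (pr τ)
      · simp [hwz]
      · have hne : (w : ℂ) - γ.toFun (pr τ) ≠ 0 := sub_ne_zero.2 fun e => hwz (Subtype.ext e)
        have h2 := (hw hwz).le
        rw [dist_eq_norm] at h2
        have h3 : f w - f (γ.toFun (pr τ)) - g (γ.toFun (pr τ)) * ((w : ℂ) - γ.toFun (pr τ)) =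
            ((f w - f (γ.toFun (pr τ))) / ((w : ℂ) - γ.toFun (pr τ)) - g (γ.toFun (pr τ))) *
              ((w : ℂ) - γ.toFun (pr τ)) := by field_simp
        rw [h3, norm_mul]
        gcongr
    have hcont : Tendsto (fun x => γ.toFun (pr x)) (𝓝 τ) (𝓝 (γ.toFun (pr τ))) :=
      (γ.toFun.continuous.comp continuous_projIcc).tendsto τ
    filter_upwards [hcont.eventually hloc] with x hx _
    have hb : ‖H x - H τ‖ ≤ (M + ε) * ‖(γ.toFun (pr x) : ℂ) - γ.toFun (pr τ)‖ := by
      have h3 : H x - H τ = (f (γ.toFun (pr x)) - f (γ.toFun (pr τ)) - g (γ.toFun (pr τ)) *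
          ((γ.toFun (pr x) : ℂ) - γ.toFun (pr τ))) + (g (γ.toFun (pr τ)) - c) *
          ((γ.toFun (pr x) : ℂ) - γ.toFun (pr τ)) := by simp only [hH]; ring
      rw [h3]
      refine (norm_add_le _ _).trans ?_
      rw [norm_mul, add_mul, add_comm]
      gcongr
    refine ⟨fun hxτ => ?_, fun hτx => ?_⟩
    · rw [norm_sub_rev]
      rw [norm_sub_rev (γ.toFun (pr x) : ℂ)] at hb
      exact hb.trans (mul_le_mul_of_nonneg_left
        (hv _ _ (Set.monotone_projIcc γ.lt.le hxτ)) hMε)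
    · exact hb.trans (mul_le_mul_of_nonneg_left
        (hv _ _ (Set.monotone_projIcc γ.lt.le hτx)) hMε)

end PathIn

/-! ### Derivatives along an effective family -/

variable {F : Set (PathIn X)}

/-- Closure under subpaths enters here: the integral identity is applied to the restriction to `[s,
t]`. -/
theorem IsFDerivative.incrementBound (hF : IsEffective F) {f g : C(X, ℂ)}
    (h : IsFDerivative F f g) {γ : PathIn X} (hγ : γ ∈ F) {v : Set.Icc γ.a γ.b → ℝ}
    (hv : γ.IsControl v) : γ.IncrementBound v f g := by
  intro s t hst c M hM
  rcases hst.eq_or_lt with rfl | hlt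
  · simp
  · have hmem := hF.subpath_mem γ hγ (γ.restrict s t s.2.1 hlt t.2.2) ⟨s, t, s.2.1, hlt, t.2.2, rfl⟩
    exact (h _ hmem).norm_sub_le (hv.restrict s.2.1 hlt t.2.2) fun u => hM _ u.2.1 u.2.2

theorem HasDerivOn.isFDerivative (hF : IsEffective F) {f g : C(X, ℂ)} (h : HasDerivOn f g) :
    IsFDerivative F f g := fun γ hγ => by
  obtain ⟨v, hv⟩ := (hF.admissible γ hγ).1.exists_isControl
  exact (PathIn.incrementBound_of_hasDerivOn hv h).hasIntegral hv.mono

theorem IsFDerivative.mul [CompactSpace X] (hF : IsEffective F) {f₁ f₂ g₁ g₂ : C(X, ℂ)}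
    (h₁ : IsFDerivative F f₁ g₁) (h₂ : IsFDerivative F f₂ g₂) :
    IsFDerivative F (f₁ * f₂) (f₁ * g₂ + g₁ * f₂) := fun γ hγ => by
  obtain ⟨v, hv⟩ := (hF.admissible γ hγ).1.exists_isControl
  exact PathIn.IncrementBound.hasIntegral_mul hv (h₁.incrementBound hF hγ hv)
    (h₂.incrementBound hF hγ hv)

theorem IsFDerivative.add {f₁ f₂ g₁ g₂ : C(X, ℂ)} (h₁ : IsFDerivative F f₁ g₁)
    (h₂ : IsFDerivative F f₂ g₂) : IsFDerivative F (f₁ + f₂) (g₁ + g₂) := fun γ hγ => by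
  have := (h₁ γ hγ).add (h₂ γ hγ)
  rwa [← add_sub_add_comm] at this

theorem IsFDerivative.smul {f g : C(X, ℂ)} (c : ℂ) (h : IsFDerivative F f g) :
    IsFDerivative F (c • f) (c • g) := fun γ hγ => by
  have := (h γ hγ).smul c
  rwa [mul_sub] at this

theorem IsFDerivative.sub {f₁ f₂ g₁ g₂ : C(X, ℂ)} (h₁ : IsFDerivative F f₁ g₁)
    (h₂ : IsFDerivative F f₂ g₂) : IsFDerivative F (f₁ - f₂) (g₁ - g₂) := by
  have h := h₁.add (h₂.smul (-1))
  rwa [neg_one_smul ℂ f₂, neg_one_smul ℂ g₂, ← sub_eq_add_neg, ← sub_eq_add_neg] at h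

theorem IsFDerivative.eq_zero (hF : IsEffective F) {g : C(X, ℂ)} (h : IsFDerivative F 0 g) :
    g = 0 := by
  have hγ0 : ∀ γ ∈ F, ∀ u, g (γ.toFun u) = 0 := by
    intro γ hγ u
    by_contra hne
    obtain ⟨δ, hδ, H⟩ := γ.exists_oscillation_le g (half_pos (norm_pos_iff.2 hne))
    -- The interval reaches at most `δ / 3` to each side of `u`, so its length is below `δ` and `g`
    -- stays within half of `‖g (γ.toFun u)‖` of its value at `u`.
    set c := max γ.a (u - δ / 3)
    set d := min γ.b (u + δ / 3)
    have hc : γ.a ≤ c := le_max_left _ _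
    have hd : d ≤ γ.b := min_le_left _ _
    have hcu : c ≤ u := max_le u.2.1 (by linarith)
    have hud : u ≤ d := le_min u.2.2 (by linarith)
    have hcd : c < d := by
      refine max_lt (lt_min γ.lt ?_) (lt_min ?_ ?_) <;> linarith [u.2.1, u.2.2]
    have hdc : d - c < δ := by
      have h1 : d ≤ u + δ / 3 := min_le_right _ _
      have h2 : u - δ / 3 ≤ c := le_max_right _ _
      linarith
    have hsub : (γ.restrict c d hc hcd hd).IsSubpath γ := ⟨c, d, hc, hcd, hd, rfl⟩
    have hmem := hF.subpath_mem γ hγ _ hsub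
    refine (hF.admissible γ hγ).2 _ hsub (PathIn.isConstant_of_incrementBound_zero
      (hF.admissible _ hmem).1 (fun v hv => h.incrementBound hF hmem hv) hne fun w => ?_)
    exact H ⟨c, hc, hcd.le.trans hd⟩ u ⟨d, hc.trans hcd.le, hd⟩ hcu hud hdc
      ⟨w, hc.trans w.2.1, w.2.2.trans hd⟩ w.2.1 w.2.2
  have hdense : Dense {z : X | g z = 0} := by
    intro z
    rw [closure_subtype]
    refine closure_mono ?_ (hF.dense z.2)
    intro w hw
    simp only [Set.mem_iUnion] at hw
    obtain ⟨γ, hγ, u, rfl⟩ := hw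
    exact ⟨γ.toFun u, hγ0 γ hγ u, rfl⟩
  have hclosed : IsClosed {z : X | g z = 0} := isClosed_eq g.continuous continuous_const
  ext z
  have : z ∈ {z : X | g z = 0} := by
    rw [← hclosed.closure_eq]
    exact hdense z
  exact this

theorem IsFDerivative.unique (hF : IsEffective F) {f g g' : C(X, ℂ)} (h : IsFDerivative F f g)
    (h' : IsFDerivative F f g') : g = g' := by
  refine sub_eq_zero.1 (IsFDerivative.eq_zero hF ?_)
  simpa using h.sub h'

theorem IsFDerivative.of_tendsto [CompactSpace X] (hF : IsEffective F) {f g : C(X, ℂ)}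
    {u w : ℕ → C(X, ℂ)} (h : ∀ n, IsFDerivative F (u n) (w n)) (hu : Tendsto u atTop (𝓝 f))
    (hw : Tendsto w atTop (𝓝 g)) : IsFDerivative F f g := fun γ hγ => by
  have hev : ∀ z : X, Tendsto (fun n => u n z) atTop (𝓝 (f z)) := fun z =>
    ((continuous_eval_const z).tendsto f).comp hu
  exact PathIn.HasIntegral.of_tendsto (hF.admissible γ hγ).1 (fun n => h n γ hγ) hw
    ((hev _).sub (hev _))

theorem hasDerivOn_coe : HasDerivOn (⟨fun z : X => (z : ℂ), continuous_subtype_val⟩ : C(X, ℂ)) 1 :=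
  fun z => by
  refine tendsto_const_nhds.congr' ?_
  filter_upwards [self_mem_nhdsWithin] with w hw
  have hne : (w : ℂ) - z ≠ 0 := sub_ne_zero.2 fun e => hw (Subtype.ext e)
  simp [div_self hne]

/-! ### The Banach function algebra -/

/-- The algebra of `F`-differentiable functions. -/
def fDiffAlgebra [CompactSpace X] (hF : IsEffective F) : Subalgebra ℂ C(X, ℂ) where
  carrier := FDifferentiable F
  mul_mem' := by
    rintro f₁ f₂ ⟨g₁, h₁⟩ ⟨g₂, h₂⟩
    exact ⟨_, h₁.mul hF h₂⟩
  add_mem' := by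
    rintro f₁ f₂ ⟨g₁, h₁⟩ ⟨g₂, h₂⟩
    exact ⟨_, h₁.add h₂⟩
  algebraMap_mem' c := ⟨0, (HasDerivOn.const c).isFDerivative hF⟩

theorem contDiffAlgebra_le_fDiffAlgebra [CompactSpace X] (hF : IsEffective F) :
    contDiffAlgebra X ≤ fDiffAlgebra hF := by
  rintro f ⟨g, h⟩
  exact ⟨g, h.isFDerivative hF⟩

/-- The `F`-derivative. -/
noncomputable def fDeriv [CompactSpace X] (hF : IsEffective F) (f : fDiffAlgebra hF) : C(X, ℂ) :=
  Classical.choose f.2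

theorem isFDerivative_fDeriv [CompactSpace X] (hF : IsEffective F) (f : fDiffAlgebra hF) :
    IsFDerivative F (f : C(X, ℂ)) (fDeriv hF f) :=
  Classical.choose_spec f.2

theorem fDeriv_eq [CompactSpace X] (hF : IsEffective F) {f : fDiffAlgebra hF} {g : C(X, ℂ)}
    (h : IsFDerivative F (f : C(X, ℂ)) g) : fDeriv hF f = g :=
  (isFDerivative_fDeriv hF f).unique hF h

theorem fDeriv_add [CompactSpace X] (hF : IsEffective F) (f₁ f₂ : fDiffAlgebra hF) :
    fDeriv hF (f₁ + f₂) = fDeriv hF f₁ + fDeriv hF f₂ :=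
  fDeriv_eq hF ((isFDerivative_fDeriv hF f₁).add (isFDerivative_fDeriv hF f₂))

theorem fDeriv_sub [CompactSpace X] (hF : IsEffective F) (f₁ f₂ : fDiffAlgebra hF) :
    fDeriv hF (f₁ - f₂) = fDeriv hF f₁ - fDeriv hF f₂ :=
  fDeriv_eq hF ((isFDerivative_fDeriv hF f₁).sub (isFDerivative_fDeriv hF f₂))

theorem fDeriv_mul [CompactSpace X] (hF : IsEffective F) (f₁ f₂ : fDiffAlgebra hF) :
    fDeriv hF (f₁ * f₂) = f₁ * fDeriv hF f₂ + fDeriv hF f₁ * f₂ :=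
  fDeriv_eq hF ((isFDerivative_fDeriv hF f₁).mul hF (isFDerivative_fDeriv hF f₂))

theorem fDeriv_smul [CompactSpace X] (hF : IsEffective F) (c : ℂ) (f : fDiffAlgebra hF) :
    fDeriv hF (c • f) = c • fDeriv hF f :=
  fDeriv_eq hF ((isFDerivative_fDeriv hF f).smul c)

/-- The norm `|f| + |f'|`. -/
noncomputable def fDiffNorm [CompactSpace X] (hF : IsEffective F) :
    AlgebraNorm ℂ (fDiffAlgebra hF) where
  toFun f := ‖(f : C(X, ℂ))‖ + ‖fDeriv hF f‖
  map_zero' := by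
    have h := fDeriv_smul hF 0 0
    rw [zero_smul, zero_smul] at h
    simp [h]
  add_le' f₁ f₂ := by
    rw [fDeriv_add]
    have h₁ := norm_add_le (f₁ : C(X, ℂ)) f₂
    have h₂ := norm_add_le (fDeriv hF f₁) (fDeriv hF f₂)
    push_cast
    linarith
  neg' f := by
    have h := fDeriv_smul hF (-1) f
    rw [neg_one_smul, neg_one_smul] at h
    simp [h]
  mul_le' f₁ f₂ := by
    rw [fDeriv_mul]
    have h₁ := norm_mul_le (f₁ : C(X, ℂ)) f₂
    have h₂ := norm_add_le ((f₁ : C(X, ℂ)) * fDeriv hF f₂) (fDeriv hF f₁ * f₂)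
    have h₃ := norm_mul_le (f₁ : C(X, ℂ)) (fDeriv hF f₂)
    have h₄ := norm_mul_le (fDeriv hF f₁) (f₂ : C(X, ℂ))
    -- By the Leibniz rule, this product is the only term of the expanded product of norms that is
    -- not needed.
    have h₅ : 0 ≤ ‖fDeriv hF f₁‖ * ‖fDeriv hF f₂‖ := by positivity
    push_cast
    linarith
  smul' c f := by
    have h := norm_smul c (f : C(X, ℂ))
    rw [← Subalgebra.coe_smul] at h
    rw [fDeriv_smul, h, norm_smul, mul_add]
  eq_zero_of_map_eq_zero' f h := by
    have h₁ := norm_nonneg (f : C(X, ℂ))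
    have h₂ := norm_nonneg (fDeriv hF f)
    exact Subtype.ext (norm_eq_zero.1 (by linarith))

theorem fDiffNorm_apply [CompactSpace X] (hF : IsEffective F) (f : fDiffAlgebra hF) :
    fDiffNorm hF f = ‖(f : C(X, ℂ))‖ + ‖fDeriv hF f‖ := rfl

theorem isBanachFunctionAlgebra_fDiffAlgebra [CompactSpace X] (hF : IsEffective F) :
    IsBanachFunctionAlgebra (fDiffAlgebra hF) (fDiffNorm hF) where
  separatesPoints z w hzw :=
    -- The coordinate function, with derivative `1`, separates points.
    ⟨_, ⟨_, ⟨1, hasDerivOn_coe.isFDerivative hF⟩, rfl⟩, fun h => hzw (Subtype.ext h)⟩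
  norm_le f := by
    rw [fDiffNorm_apply]
    exact le_add_of_nonneg_right (norm_nonneg _)
  complete u hu := by
    simp only [fDiffNorm_apply, fDeriv_sub] at hu ⊢
    have hc₁ : CauchySeq fun n => (u n : C(X, ℂ)) := by
      refine Metric.cauchySeq_iff.2 fun ε hε => ?_
      obtain ⟨n₀, H⟩ := hu ε hε
      refine ⟨n₀, fun m hm n hn => ?_⟩
      rw [dist_eq_norm]
      exact (le_add_of_nonneg_right (norm_nonneg _)).trans_lt (H m hm n hn)
    have hc₂ : CauchySeq fun n => fDeriv hF (u n) := by
      refine Metric.cauchySeq_iff.2 fun ε hε => ?_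
      obtain ⟨n₀, H⟩ := hu ε hε
      refine ⟨n₀, fun m hm n hn => ?_⟩
      rw [dist_eq_norm]
      exact (le_add_of_nonneg_left (norm_nonneg _)).trans_lt (H m hm n hn)
    obtain ⟨f, hf⟩ := cauchySeq_tendsto_of_complete hc₁
    obtain ⟨g, hg⟩ := cauchySeq_tendsto_of_complete hc₂
    have hfg : IsFDerivative F f g :=
      IsFDerivative.of_tendsto hF (fun n => isFDerivative_fDeriv hF (u n)) hf hg
    refine ⟨⟨f, g, hfg⟩, ?_⟩
    rw [fDeriv_eq hF (f := ⟨f, g, hfg⟩) hfg]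
    simpa using (tendsto_iff_norm_sub_tendsto_zero.1 hf).add
      (tendsto_iff_norm_sub_tendsto_zero.1 hg)

end PlaneDiff

theorem mainTheorem7 (X : Set ℂ) [CompactSpace X] (hX : PlaneDiff.IsSemiRectifiable X)
    (F : Set (PlaneDiff.PathIn X)) (hF : PlaneDiff.IsEffective F) :
    (∀ f₁ f₂ g₁ g₂ : C(X, ℂ), PlaneDiff.IsFDerivative F f₁ g₁ → PlaneDiff.IsFDerivative F f₂ g₂ →
      PlaneDiff.IsFDerivative F (f₁ * f₂) (f₁ * g₂ + g₁ * f₂)) ∧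
    (∀ f g g' : C(X, ℂ), PlaneDiff.IsFDerivative F f g → PlaneDiff.IsFDerivative F f g' → g = g') ∧
    ∃ (A : Subalgebra ℂ C(X, ℂ)) (N : AlgebraNorm ℂ A),
      (A : Set C(X, ℂ)) = PlaneDiff.FDifferentiable F ∧
      (∀ (f : A) (g : C(X, ℂ)), PlaneDiff.IsFDerivative F (f : C(X, ℂ)) g →
        N f = ‖(f : C(X, ℂ))‖ + ‖g‖) ∧
      PlaneDiff.IsBanachFunctionAlgebra A N ∧
      PlaneDiff.contDiffAlgebra X ≤ A := by
  exact ⟨fun _ _ _ _ h₁ h₂ => h₁.mul hF h₂, fun _ _ _ h h' => h.unique hF h',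
    PlaneDiff.fDiffAlgebra hF, PlaneDiff.fDiffNorm hF, rfl,
    fun f g h => by rw [PlaneDiff.fDiffNorm_apply, PlaneDiff.fDeriv_eq hF h],
    PlaneDiff.isBanachFunctionAlgebra_fDiffAlgebra hF,
    PlaneDiff.contDiffAlgebra_le_fDiffAlgebra hF⟩
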